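/- Let $E$ be an infinite-dimensional real Banach space that has an unconditional Schauder basis $\{e_n\}_{n\in\mathbb N}$ and that admits an equivalent norm $N$ which is of class $C^1$ on $E\setminus\{0\}$ and locally depends on finitely many coordinates, that is: for every $x\in E\setminus\{0\}$ there are an open neighbourhood $V_x$ of $x$, a natural number $l_x$, continuous linear functionals $L_1,\dots,L_{l_x}\in E^*$ and a function $\gamma:\mathbb R^{l_x}\to\mathbb R$ such that $N(y)=\gamma(L_1(y),\dots,L_{l_x}(y))$ for every $y\in V_x$. Let $d$ be a natural number, $U\subseteq E$ an open set, $f:U\to\mathbb R^d$ a $C^1$ function and $\varepsilon:U\to(0,\infty)$ a continuous function. Then there exists a $C^1$ function $g:U\to\mathbb R^d$ such that 1. $\|f(x)-g(x)\|\le\varepsilon(x)$ for every $x\in U$; 2. $\|Df(x)-Dg(x)\|\le\varepsilon(x)$ for every $x\in U$; 3. $C_g=\emptyset$, where $C_g:=\{x\in U:\ Dg(x) \text{ is not surjective}\}$, i.e. $g$ has no critical points. Here $\mathbb R^d$ carries the Euclidean norm, $Df(x),Dg(x):E\to\mathbb R^d$ are the Fréchet derivatives, and $\|Df(x)-Dg(x)\|$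 is the operator norm. -/

import Mathlib

open Set Filter Topology

/-- A seminorm `N` on a normed space `E` is an equivalent norm if it is bounded above and below by
positive multiples of the given norm of `E` (so it is a norm, inducing the same topology). -/
def IsEquivalentNorm {E : Type*} [NormedAddCommGroup E] [NormedSpace ℝ E]
    (N : Seminorm ℝ E) : Prop :=
  ∃ c C : ℝ, 0 < c ∧ 0 < C ∧ ∀ x : E, c * ‖x‖ ≤ N x ∧ N x ≤ C * ‖x‖

/-- A norm is of class `C¹` if it is continuously differentiable away from the origin
(no norm on a nontrivial space is differentiable at the origin). -/
def IsC1Norm {E : Type*} [NormedAddCommGroup E] [NormedSpace ℝ E]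
    (N : Seminorm ℝ E) : Prop :=
  ContDiffOn ℝ 1 (fun x : E => N x) {0}ᶜ

/-- A norm `N` locally depends on finitely many coordinates if near every nonzero point `x` it is
a function of finitely many continuous linear functionals.  The origin has to be left out: in an
infinite-dimensional space no norm is of this form near the origin, because it would vanish on the
intersection of the kernels of the functionals. -/
def LocallyDependsOnFinitelyManyCoordinates {E : Type*} [NormedAddCommGroup E] [NormedSpace ℝ E]
    (N : Seminorm ℝ E) : Prop :=
  ∀ x : E, x ≠ 0 → ∃ (l : ℕ) (V : Set E) (L : Fin l → E →L[ℝ] ℝ) (γ : (Fin l → ℝ) → ℝ),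
    IsOpen V ∧ x ∈ V ∧ ∀ y ∈ V, N y = γ (fun i => L i y)

/-- The set of critical points in `U` of a map `g` defined on `U`: the points at which the
Fréchet derivative is not surjective. -/
def criticalSet {E F : Type*} [NormedAddCommGroup E] [NormedSpace ℝ E]
    [NormedAddCommGroup F] [NormedSpace ℝ F] (g : E → F) (U : Set E) : Set E :=
  {x | x ∈ U ∧ ¬ Function.Surjective (fderiv ℝ g x)}

/-! The proof keeps all but finitely many directions of the differentials inside the algebraic span
`M` of a countable set of functionals. By Baire, a countable set cannot span the
infinite-dimensional Banach space `E →L[ℝ] ℝ`, so there is an operator `T` into `ℝᵈ` with no nonzero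
combination of its components in `M`. If `Dg - ρ T` has its components in `M` and `ρ ≠ 0`, then `Dg`
is onto: a nonzero functional `l` killing its range would put `l ∘ T` in `M`.

The norm supplies such functions. `E` is separable, so by Lindelöf countably many functionals span
all the differentials of `N`; composing `N` with a smooth step gives a cutoff `θ`. Damping the
`n`-th coordinate of `x` by `θ` of its `n`-th tail, then rescaling, gives maps `Ψ` uniformly close
to the identity with `l ∘ DΨ` in `M` for every functional `l`. Unconditionality bounds `DΨ`
independently of the scale.

`DΨ` is bounded but not close to the identity, so `f ∘ Ψ` need not be `C¹`-close to `f`. On a ball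
where `Df` is nearly a constant `A`, the map `f ∘ Ψ + A (id - Ψ)` is: only the small part `Df - A`
gets composed with `DΨ`. This adds the components of `A` to the span, and countably many balls
suffice. Adding a small multiple of `T` on each ball and gluing by a partition of unity with
differentials in `M` gives `g`. -/

/-! ### Diagonal operators for an unconditional basis. -/

/-- A linear combination with coefficients in `[0, 1]` is bounded by any bound for the partial
sums over subsets. -/
theorem norm_add_sum_smul_le_of_forall_subset {E ι : Type*} [NormedAddCommGroup E]
    [NormedSpace ℝ E] (v : ι → E) (a : ι → ℝ) (ha : ∀ i, 0 ≤ a i ∧ a i ≤ 1) (B : ℝ)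
    (F : Finset ι) (u : E) (h : ∀ G ⊆ F, ‖u + ∑ i ∈ G, v i‖ ≤ B) :
    ‖u + ∑ i ∈ F, a i • v i‖ ≤ B := by
  classical
  induction F using Finset.induction_on generalizing u with
  | empty => simpa using h ∅ (Finset.Subset.refl _)
  | insert j F hj ih =>
    have h0 := ih u fun G hG => h G (hG.trans (Finset.subset_insert _ _))
    have h1 := ih (u + v j) fun G hG => by
      have := h (insert j G) (Finset.insert_subset_insert _ hG)
      rwa [Finset.sum_insert (fun hh => hj (hG hh)), ← add_assoc] at this
    rw [Finset.sum_insert hj]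
    -- The sum is affine in `a j`, hence a convex combination of its values at `a j = 0` and `a j =
    -- 1`.
    have e : u + (a j • v j + ∑ i ∈ F, a i • v i) =
        (1 - a j) • (u + ∑ i ∈ F, a i • v i) + a j • (u + v j + ∑ i ∈ F, a i • v i) := by
      module
    rw [e]
    obtain ⟨p, q⟩ := ha j
    calc _ ≤ (1 - a j) * ‖u + ∑ i ∈ F, a i • v i‖ + a j * ‖u + v j + ∑ i ∈ F, a i • v i‖ := by
          refine (norm_add_le _ _).trans_eq ?_
          rw [norm_smul, norm_smul, Real.norm_of_nonneg p, Real.norm_of_nonneg (sub_nonneg.2 q)]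
      _ ≤ (1 - a j) * B + a j * B := by gcongr
      _ = B := by ring

/-- Diagonal operators with bounded coefficients are bounded on a space with an unconditional
basis. -/
theorem UnconditionalSchauderBasis.norm_sum_mul_coord_smul_le {E ι : Type*} [NormedAddCommGroup E]
    [NormedSpace ℝ E] (b : UnconditionalSchauderBasis ι ℝ E) {K : ℝ}
    (hK : ∀ A : Finset ι, ‖b.proj A‖ ≤ K) (F : Finset ι) (c : ι → ℝ) {B : ℝ} (hB : 0 ≤ B)
    (hc : ∀ i ∈ F, |c i| ≤ B) (x : E) :
    ‖∑ i ∈ F, (c i * b.coord i x) • b i‖ ≤ 2 * K * B * ‖x‖ := by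
  have key : ∀ a : ι → ℝ, (∀ i, 0 ≤ a i ∧ a i ≤ 1) →
      ‖∑ i ∈ F, (a i * b.coord i x) • b i‖ ≤ K * ‖x‖ := by
    intro a ha
    have := norm_add_sum_smul_le_of_forall_subset (fun i => b.coord i x • b i) a ha (K * ‖x‖) F 0
      (fun G _ => by
        rw [zero_add, ← b.proj_apply]
        exact ((b.proj G).le_opNorm x).trans (by gcongr; exact hK G))
    simpa [smul_smul] using this
  rcases hB.eq_or_lt with rfl | hB
  · rw [Finset.sum_eq_zero fun i hi => ?_]
    · simp
    · rw [abs_nonpos_iff.1 (hc i hi)]; simp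
  -- Positive and negative parts of `c / B`. The `min 1` matters only off `F`, where `c` is not
  -- controlled but `key` still asks for coefficients in `[0, 1]`.
  have e : ∑ i ∈ F, (c i * b.coord i x) • b i =
      B • (∑ i ∈ F, (min 1 (max (c i / B) 0) * b.coord i x) • b i
        - ∑ i ∈ F, (min 1 (max (-(c i / B)) 0) * b.coord i x) • b i) := by
    rw [← Finset.sum_sub_distrib, Finset.smul_sum]
    refine Finset.sum_congr rfl fun i hi => ?_
    rw [← sub_smul, smul_smul]
    congr 1
    obtain ⟨h1, h2⟩ := abs_le.1 (hc i hi)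
    have h3 : c i / B ≤ 1 := by rw [div_le_one hB]; exact h2
    have h4 : -(c i / B) ≤ 1 := by rw [← neg_div, div_le_one hB]; linarith
    rw [min_eq_right (max_le h3 zero_le_one), min_eq_right (max_le h4 zero_le_one)]
    have h5 : max (c i / B) 0 - max (-(c i / B)) 0 = c i / B := by
      rcases le_total (c i / B) 0 with h | h
      · rw [max_eq_right h, max_eq_left (by linarith)]; ring
      · rw [max_eq_left h, max_eq_right (by linarith)]; ring
    rw [← sub_mul, h5]
    field_simp
  rw [e, norm_smul, Real.norm_of_nonneg hB.le]
  have h1 := key (fun i => min 1 (max (c i / B) 0)) fun i => ⟨by positivity, min_le_left _ _⟩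
  have h2 := key (fun i => min 1 (max (-(c i / B)) 0)) fun i => ⟨by positivity, min_le_left _ _⟩
  calc _ ≤ B * (K * ‖x‖ + K * ‖x‖) := by
        gcongr; exact (norm_sub_le _ _).trans (add_le_add h1 h2)
    _ = _ := by ring

/-! ### Cutoffs with differentials in a countable span. -/

theorem Real.smoothTransition.exists_abs_deriv_le :
    ∃ S : ℝ, ∀ t, |deriv Real.smoothTransition t| ≤ S := by
  have hd : Continuous (deriv Real.smoothTransition) :=
    (Real.smoothTransition.contDiff (n := 1)).continuous_deriv (by simp)
  obtain ⟨S, hS⟩ := isCompact_Icc.exists_bound_of_continuousOn (s := Icc (0 : ℝ) 1) hd.continuousOn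
  refine ⟨max S 0, fun t => ?_⟩
  by_cases ht : t ∈ Icc (0 : ℝ) 1
  · exact (hS t ht).trans (le_max_left _ _)
  · have : deriv Real.smoothTransition t = 0 := by
      rw [mem_Icc, not_and_or, not_le, not_le] at ht
      rcases ht with ht | ht
      · have : Real.smoothTransition =ᶠ[𝓝 t] fun _ => 0 := by
          filter_upwards [gt_mem_nhds ht] with y hy
          exact Real.smoothTransition.zero_of_nonpos hy.le
        rw [this.deriv_eq]; simp
      · have : Real.smoothTransition =ᶠ[𝓝 t] fun _ => 1 := by
          filter_upwards [lt_mem_nhds ht] with y hy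
          exact Real.smoothTransition.one_of_one_le hy.le
        rw [this.deriv_eq]; simp
    simp [this]

/-- A continuous functional which vanishes on the common kernel of finitely many continuous
functionals is a linear combination of them. -/
theorem ContinuousLinearMap.mem_span_range_of_forall_eq_zero {E ι : Type*} [NormedAddCommGroup E]
    [NormedSpace ℝ E] [Finite ι] (L : ι → E →L[ℝ] ℝ) (φ : E →L[ℝ] ℝ)
    (h : ∀ w, (∀ i, L i w = 0) → φ w = 0) : φ ∈ Submodule.span ℝ (range L) := by
  cases nonempty_fintype ι
  have : (φ : E →ₗ[ℝ] ℝ) ∈ Submodule.span ℝ (range fun i => (L i : E →ₗ[ℝ] ℝ)) := by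
    refine mem_span_of_iInf_ker_le_ker fun w hw => ?_
    simp only [Submodule.mem_iInf, LinearMap.mem_ker] at hw ⊢
    exact h w hw
  rw [Submodule.mem_span_range_iff_exists_fun] at this ⊢
  obtain ⟨c, hc⟩ := this
  refine ⟨c, ?_⟩
  ext w
  have := congrArg (fun l : E →ₗ[ℝ] ℝ => l w) hc
  simpa using this

/-- The derivative of a norm which locally depends on finitely many coordinates takes its values
in the span of a countable set. -/
theorem LocallyDependsOnFinitelyManyCoordinates.exists_countable_fderiv_mem_span {E : Type*}
    [NormedAddCommGroup E] [NormedSpace ℝ E] [SecondCountableTopology E] {N : Seminorm ℝ E}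
    (hN : IsC1Norm N) (hL : LocallyDependsOnFinitelyManyCoordinates N) :
    ∃ s : Set (E →L[ℝ] ℝ), s.Countable ∧
      ∀ z, z ≠ 0 → fderiv ℝ (fun x => N x) z ∈ Submodule.span ℝ s := by
  choose! l V L γ hV hx hγ using hL
  obtain ⟨t, ht, htc, hcov⟩ := TopologicalSpace.countable_cover_nhdsWithin (s := ({0}ᶜ : Set E))
    (f := V) fun x hx' => mem_nhdsWithin_of_mem_nhds ((hV x hx').mem_nhds (hx x hx'))
  refine ⟨⋃ x ∈ t, range (L x), htc.biUnion fun x _ => countable_range _, fun z hz => ?_⟩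
  obtain ⟨x, hxt, hzx⟩ := mem_iUnion₂.1 (hcov hz)
  have hx0 : x ≠ 0 := ht hxt
  refine Submodule.span_mono (subset_biUnion_of_mem (u := fun x => range (L x)) hxt)
    (ContinuousLinearMap.mem_span_range_of_forall_eq_zero _ _ fun w hw => ?_)
  have hd : DifferentiableAt ℝ (fun x => N x) z :=
    (hN.contDiffAt (isOpen_compl_singleton.mem_nhds hz)).differentiableAt (by simp)
  have hline : HasDerivAt (fun τ : ℝ => N (z + τ • w)) (fderiv ℝ (fun x => N x) z w) 0 :=
    hd.hasFDerivAt.hasLineDerivAt w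
  -- Moving along a common kernel vector `w` does not change the arguments of `γ`.
  have hconst : (fun τ : ℝ => N (z + τ • w)) =ᶠ[𝓝 0] fun _ => N z := by
    have hcont : Tendsto (fun τ : ℝ => z + τ • w) (𝓝 0) (𝓝 z) := by
      have : Continuous fun τ : ℝ => z + τ • w := by fun_prop
      simpa using this.tendsto 0
    filter_upwards [hcont ((hV x hx0).mem_nhds hzx)] with τ hτ
    rw [hγ x hx0 _ hτ, hγ x hx0 _ hzx]
    simp [hw]
  exact hline.unique ((hasDerivAt_const (0 : ℝ) (N z)).congr_of_eventuallyEq hconst)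

/-- A `C¹` function vanishing near the origin and equal to `1` off the unit ball, with bounded
derivative, all of whose differentials belong to `M`. -/
structure IsCutoff {E : Type*} [NormedAddCommGroup E] [NormedSpace ℝ E]
    (M : Submodule ℝ (E →L[ℝ] ℝ)) (θ : E → ℝ) (a S : ℝ) : Prop where
  pos : 0 < a
  contDiff : ContDiff ℝ 1 θ
  nonneg : ∀ z, 0 ≤ θ z
  le_one : ∀ z, θ z ≤ 1
  eq_zero : ∀ z, ‖z‖ < a → θ z = 0
  eq_one : ∀ z, 1 ≤ ‖z‖ → θ z = 1
  norm_fderiv_le : ∀ z, ‖fderiv ℝ θ z‖ ≤ S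
  fderiv_mem : ∀ z, fderiv ℝ θ z ∈ M

/-- A step function of `N` that is flat near the origin hides the singularity of `N` there, and its
differentials are multiples of those of `N`. -/
theorem exists_isCutoff {E : Type*} [NormedAddCommGroup E] [NormedSpace ℝ E]
    [SecondCountableTopology E] {N : Seminorm ℝ E} (hE : IsEquivalentNorm N) (hN : IsC1Norm N)
    (hL : LocallyDependsOnFinitelyManyCoordinates N) :
    ∃ (s : Set (E →L[ℝ] ℝ)) (θ : E → ℝ) (a S : ℝ), s.Countable ∧
      IsCutoff (Submodule.span ℝ s) θ a S := by
  obtain ⟨s, hs, hmem⟩ := hL.exists_countable_fderiv_mem_span hN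
  obtain ⟨c, C, hc, hC, hcC⟩ := hE
  obtain ⟨S, hS⟩ := Real.smoothTransition.exists_abs_deriv_le
  have hS0 : 0 ≤ S := (abs_nonneg _).trans (hS 0)
  -- The argument is nonpositive when `N z ≤ c / 2`, and at least `1` when `N z ≥ c`, hence off the
  -- unit ball.
  set θ : E → ℝ := fun z => Real.smoothTransition (2 / c * N z - 1) with hθ
  have hzero : ∀ z, ‖z‖ < c / (2 * C) → θ z = 0 := fun z hz => by
    refine Real.smoothTransition.zero_of_nonpos ?_
    have h1 : N z ≤ c / 2 := calc
      N z ≤ C * ‖z‖ := (hcC z).2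
      _ ≤ C * (c / (2 * C)) := by gcongr
      _ = c / 2 := by field_simp
    have : 2 / c * N z ≤ 2 / c * (c / 2) := by gcongr
    have e : 2 / c * (c / 2) = 1 := by field_simp
    linarith
  have ha : 0 < c / (2 * C) := by positivity
  have hev : θ =ᶠ[𝓝 0] fun _ => 0 := by
    filter_upwards [Metric.ball_mem_nhds (0 : E) ha] with z hz
    exact hzero z (by simpa using hz)
  have hder : ∀ z, z ≠ 0 → HasFDerivAt θ
      ((deriv Real.smoothTransition (2 / c * N z - 1) * (2 / c)) • fderiv ℝ (fun x => N x) z) z := by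
    intro z hz
    have hd : DifferentiableAt ℝ (fun x => N x) z :=
      (hN.contDiffAt (isOpen_compl_singleton.mem_nhds hz)).differentiableAt (by simp)
    have h1 : HasDerivAt Real.smoothTransition (deriv Real.smoothTransition (2 / c * N z - 1))
        (2 / c * N z - 1) :=
      ((Real.smoothTransition.contDiff (n := 1)).differentiable (by simp) _).hasDerivAt
    have h2 := h1.comp_hasFDerivAt z ((hd.hasFDerivAt.const_mul (2 / c)).sub_const 1)
    rw [smul_smul] at h2
    exact h2
  have hfz : fderiv ℝ θ 0 = 0 := by rw [hev.fderiv_eq]; simp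
  refine ⟨s, θ, c / (2 * C), S * (2 / c) * C, hs, ha, ?_, fun z => Real.smoothTransition.nonneg _,
    fun z => Real.smoothTransition.le_one _, hzero, fun z hz => ?_, fun z => ?_, fun z => ?_⟩
  · rw [contDiff_iff_contDiffAt]
    intro z
    by_cases hz : z = 0
    · subst hz
      exact contDiffAt_const.congr_of_eventuallyEq hev
    · have hNz : ContDiffAt ℝ 1 (fun x => N x) z :=
        hN.contDiffAt (isOpen_compl_singleton.mem_nhds hz)
      exact (Real.smoothTransition.contDiff (n := 1)).contDiffAt.comp z
        ((contDiffAt_const.mul hNz).sub contDiffAt_const)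
  · refine Real.smoothTransition.one_of_one_le ?_
    have h1 : c ≤ N z := le_trans (by nlinarith) (hcC z).1
    have : 2 / c * c ≤ 2 / c * N z := by gcongr
    have e : 2 / c * c = 2 := by field_simp
    linarith
  · by_cases hz : z = 0
    · subst hz; rw [hfz, norm_zero]; positivity
    · rw [(hder z hz).fderiv, norm_smul, norm_mul, Real.norm_eq_abs,
        Real.norm_of_nonneg (by positivity : 0 ≤ 2 / c)]
      have : ‖fderiv ℝ (fun x => N x) z‖ ≤ C := by
        refine norm_fderiv_le_of_lip' ℝ hC.le (Eventually.of_forall fun y => ?_)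
        rw [Real.norm_eq_abs]
        refine le_trans ?_ (hcC (y - z)).2
        exact abs_sub_map_le_sub N y z
      gcongr
      exact hS _
  · by_cases hz : z = 0
    · subst hz; rw [hfz]; exact zero_mem _
    · rw [(hder z hz).fderiv]; exact Submodule.smul_mem _ _ (hmem z hz)

/-! ### Smoothed truncation of the identity. -/

namespace UnconditionalSchauderBasis

variable {E : Type*} [NormedAddCommGroup E] [NormedSpace ℝ E]

/-- The projection of `x` onto the closed span of the basis vectors of index at least `n`. -/
noncomputable def tail (b : UnconditionalSchauderBasis ℕ ℝ E) (n : ℕ) : E →L[ℝ] E :=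
  ContinuousLinearMap.id ℝ E - b.proj (Finset.range n)

variable (b : UnconditionalSchauderBasis ℕ ℝ E)

theorem tail_apply (n : ℕ) (x : E) :
    b.tail n x = x - ∑ k ∈ Finset.range n, b.coord k x • b k := by
  simp [tail]

theorem tendsto_tail (x : E) : Tendsto (fun n => b.tail n x) atTop (𝓝 0) := by
  have h := (b.expansion x).tendsto_sum_nat
  have := (tendsto_const_nhds (x := x)).sub h
  simpa [tail_apply] using this

theorem coord_tail {n k : ℕ} (h : n ≤ k) (x : E) : b.coord k (b.tail n x) = b.coord k x := by
  rw [tail_apply, map_sub, map_sum, Finset.sum_eq_zero, sub_zero]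
  intro i hi
  have hki : k ≠ i := by have := Finset.mem_range.1 hi; omega
  have h0 : b.coord k (b i) = 0 := by simp [b.ortho, hki]
  rw [map_smul, h0, smul_zero]

theorem norm_tail_le {K : ℝ} (hK : ∀ A : Finset ℕ, ‖b.proj A‖ ≤ K) (n : ℕ) (x : E) :
    ‖b.tail n x‖ ≤ (1 + K) * ‖x‖ := by
  have : ‖b.tail n x‖ ≤ ‖x‖ + ‖b.proj (Finset.range n) x‖ := norm_sub_le _ _
  have h2 := (b.proj (Finset.range n)).le_of_opNorm_le (hK _) x
  linarith

theorem comp_tail_mem {M : Submodule ℝ (E →L[ℝ] ℝ)} (hM : ∀ n, b.coord n ∈ M) {φ : E →L[ℝ] ℝ}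
    (hφ : φ ∈ M) (n : ℕ) : φ.comp (b.tail n) ∈ M := by
  have : φ.comp (b.tail n) = φ - ∑ k ∈ Finset.range n, φ (b k) • b.coord k := by
    ext x
    simp [tail_apply, mul_comm]
  rw [this]
  exact M.sub_mem hφ (M.sum_mem fun k _ => M.smul_mem _ (hM k))

/-- The smoothed truncation operator: the `n`-th coordinate of `x` is damped by a factor which
vanishes as soon as the `n`-th tail of `x` is small. -/
noncomputable def damp (θ : E → ℝ) (x : E) : E :=
  ∑' n, (θ (b.tail n x) * b.coord n x) • b n

variable {b} {M : Submodule ℝ (E →L[ℝ] ℝ)} {θ : E → ℝ} {a S K : ℝ}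

/-- Tails tend to zero pointwise and are equicontinuous. This makes the sum defining `damp` locally
finite. -/
theorem exists_eventually_norm_tail_lt (hK : ∀ A : Finset ℕ, ‖b.proj A‖ ≤ K) (ha : 0 < a)
    (x : E) : ∃ m, ∀ᶠ y in 𝓝 x, ∀ n, m ≤ n → ‖b.tail n y‖ < a := by
  have hK0 : 0 ≤ K := (norm_nonneg _).trans (hK ∅)
  have h1 : ∀ᶠ n in atTop, ‖b.tail n x‖ < a / 2 := by
    have := (b.tendsto_tail x).norm
    rw [norm_zero] at this
    exact this.eventually_lt_const (by positivity)
  obtain ⟨m, hm⟩ := eventually_atTop.1 h1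
  refine ⟨m, ?_⟩
  filter_upwards [Metric.ball_mem_nhds x (by positivity : 0 < a / (2 * (1 + K)))] with y hy n hn
  have h2 := b.norm_tail_le hK n (y - x)
  have h3 : (1 + K) * ‖y - x‖ < a / 2 := by
    rw [mem_ball_iff_norm] at hy
    calc (1 + K) * ‖y - x‖ < (1 + K) * (a / (2 * (1 + K))) := by gcongr
      _ = a / 2 := by field_simp
  have e : b.tail n y = b.tail n x + b.tail n (y - x) := by rw [map_sub]; abel
  rw [e]
  linarith [norm_add_le (b.tail n x) (b.tail n (y - x)), hm n hn]

theorem damp_eq_sum (hθ : IsCutoff M θ a S) {m : ℕ} {x : E}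
    (h : ∀ n, m ≤ n → ‖b.tail n x‖ < a) :
    b.damp θ x = ∑ n ∈ Finset.range m, (θ (b.tail n x) * b.coord n x) • b n := by
  refine tsum_eq_sum fun n hn => ?_
  rw [hθ.eq_zero _ (h n (by simpa using hn)), zero_mul, zero_smul]

theorem exists_damp_eventuallyEq (hK : ∀ A : Finset ℕ, ‖b.proj A‖ ≤ K) (hθ : IsCutoff M θ a S)
    (x : E) : ∃ m, (∀ n, m ≤ n → ‖b.tail n x‖ < a) ∧ b.damp θ =ᶠ[𝓝 x]
      fun y => ∑ n ∈ Finset.range m, (θ (b.tail n y) * b.coord n y) • b n := by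
  obtain ⟨m, hm⟩ := exists_eventually_norm_tail_lt (b := b) hK hθ.pos x
  exact ⟨m, hm.self_of_nhds, hm.mono fun y hy => damp_eq_sum hθ hy⟩

theorem contDiff_damp (hK : ∀ A : Finset ℕ, ‖b.proj A‖ ≤ K) (hθ : IsCutoff M θ a S) :
    ContDiff ℝ 1 (b.damp θ) := by
  rw [contDiff_iff_contDiffAt]
  intro x
  obtain ⟨m, -, hm⟩ := exists_damp_eventuallyEq (b := b) hK hθ x
  refine ContDiffAt.congr_of_eventuallyEq (ContDiff.contDiffAt ?_) hm
  refine ContDiff.sum fun n _ => ContDiff.smul (ContDiff.mul ?_ (b.coord n).contDiff) contDiff_const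
  exact hθ.contDiff.comp (b.tail n).contDiff

theorem exists_fderiv_damp_eq (hK : ∀ A : Finset ℕ, ‖b.proj A‖ ≤ K) (hθ : IsCutoff M θ a S)
    (x : E) : ∃ m, fderiv ℝ (b.damp θ) x = ∑ n ∈ Finset.range m,
      (θ (b.tail n x) • b.coord n +
        b.coord n x • (fderiv ℝ θ (b.tail n x)).comp (b.tail n)).smulRight (b n) := by
  obtain ⟨m, -, hm⟩ := exists_damp_eventuallyEq (b := b) hK hθ x
  refine ⟨m, (HasFDerivAt.congr_of_eventuallyEq ?_ hm).fderiv⟩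
  refine HasFDerivAt.fun_sum fun n _ => ?_
  have h1 : HasFDerivAt (fun y => θ (b.tail n y))
      ((fderiv ℝ θ (b.tail n x)).comp (b.tail n)) x :=
    ((hθ.contDiff.differentiable (by simp) _).hasFDerivAt).comp x (b.tail n).hasFDerivAt
  exact (h1.mul (b.coord n).hasFDerivAt).smul_const (b n)

/-- The differential is a finite sum built from coordinate functionals and from `Dθ ∘ tail`; the
latter differs from `Dθ` by finitely many coordinates. -/
theorem comp_fderiv_damp_mem (hK : ∀ A : Finset ℕ, ‖b.proj A‖ ≤ K) (hθ : IsCutoff M θ a S)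
    (hM : ∀ n, b.coord n ∈ M) (x : E) (l : E →L[ℝ] ℝ) :
    l.comp (fderiv ℝ (b.damp θ) x) ∈ M := by
  obtain ⟨m, hm⟩ := exists_fderiv_damp_eq (b := b) hK hθ x
  have : l.comp (fderiv ℝ (b.damp θ) x) = ∑ n ∈ Finset.range m, l (b n) •
      (θ (b.tail n x) • b.coord n +
        b.coord n x • (fderiv ℝ θ (b.tail n x)).comp (b.tail n)) := by
    rw [hm]
    ext h
    simp [mul_comm, mul_add]
  rw [this]
  exact M.sum_mem fun n _ => M.smul_mem _ (M.add_mem (M.smul_mem _ (hM n))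
    (M.smul_mem _ (b.comp_tail_mem hM (hθ.fderiv_mem _) n)))

theorem fderiv_eq_zero_of_one_lt_norm (hθ : IsCutoff M θ a S) {z : E} (hz : 1 < ‖z‖) :
    fderiv ℝ θ z = 0 := by
  have : θ =ᶠ[𝓝 z] fun _ => 1 := by
    filter_upwards [continuous_norm.continuousAt.eventually (lt_mem_nhds hz)] with y hy
    exact hθ.eq_one y hy.le
  rw [this.fderiv_eq]
  simp

/-- From the first index with small tail on, the coordinates of `x` are those of a vector of the
unit ball. -/
theorem norm_sum_mul_coord_smul_le_of_small_tail (hK : ∀ A : Finset ℕ, ‖b.proj A‖ ≤ K)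
    (m : ℕ) (x : E) (c : ℕ → ℝ) {B : ℝ} (hB : 0 ≤ B) (hc : ∀ n, |c n| ≤ B)
    (h0 : ∀ n, 1 < ‖b.tail n x‖ → c n = 0) :
    ‖∑ n ∈ Finset.range m, (c n * b.coord n x) • b n‖ ≤ 2 * K * B := by
  have hK0 : 0 ≤ K := (norm_nonneg _).trans (hK ∅)
  have hex : ∃ n, ‖b.tail n x‖ ≤ 1 := by
    obtain ⟨m, hm⟩ := exists_eventually_norm_tail_lt (b := b) hK one_pos x
    exact ⟨m, (hm.self_of_nhds m le_rfl).le⟩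
  classical
  have e : ∑ n ∈ Finset.range m, (c n * b.coord n x) • b n =
      ∑ n ∈ Finset.range m, (c n * b.coord n (b.tail (Nat.find hex) x)) • b n := by
    refine Finset.sum_congr rfl fun n _ => ?_
    by_cases hn : Nat.find hex ≤ n
    · rw [b.coord_tail hn]
    -- Before the first small tail every tail has norm above `1`, so the coefficient is zero.
    · rw [h0 n (not_le.1 (Nat.find_min hex (not_le.1 hn))), zero_mul, zero_mul]
  rw [e]
  refine (b.norm_sum_mul_coord_smul_le hK _ c hB (fun n _ => hc n) _).trans ?_
  exact mul_le_of_le_one_right (by positivity) (Nat.find_spec hex)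

theorem norm_damp_sub_le (hK : ∀ A : Finset ℕ, ‖b.proj A‖ ≤ K) (hθ : IsCutoff M θ a S) (x : E) :
    ‖b.damp θ x - x‖ ≤ a + 2 * K := by
  obtain ⟨m, hm, hm'⟩ := exists_damp_eventuallyEq (b := b) hK hθ x
  have e : b.damp θ x - x =
      -(b.tail m x + ∑ n ∈ Finset.range m, ((1 - θ (b.tail n x)) * b.coord n x) • b n) := by
    rw [hm'.self_of_nhds, tail_apply]
    simp only [sub_mul, one_mul, sub_smul, Finset.sum_sub_distrib]
    abel
  rw [e, norm_neg]
  refine (norm_add_le _ _).trans (add_le_add (hm m le_rfl).le ?_)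
  have := norm_sum_mul_coord_smul_le_of_small_tail hK m x (fun n => 1 - θ (b.tail n x))
    zero_le_one (fun n => ?_) (fun n hn => ?_)
  · simpa using this
  · rw [abs_le]
    constructor <;> linarith [hθ.nonneg (b.tail n x), hθ.le_one (b.tail n x)]
  · simp [hθ.eq_one _ hn.le]

/-- The terms with `Dθ` carry coordinates of `x`, yet survive only where the tail lies in the unit
ball; hence a bound independent of `x`. -/
theorem norm_fderiv_damp_le (hK : ∀ A : Finset ℕ, ‖b.proj A‖ ≤ K) (hθ : IsCutoff M θ a S)
    (x : E) : ‖fderiv ℝ (b.damp θ) x‖ ≤ 2 * K + 2 * K * (S * (1 + K)) := by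
  have hK0 : 0 ≤ K := (norm_nonneg _).trans (hK ∅)
  have hS0 : 0 ≤ S := (norm_nonneg _).trans (hθ.norm_fderiv_le 0)
  obtain ⟨m, hm⟩ := exists_fderiv_damp_eq (b := b) hK hθ x
  refine ContinuousLinearMap.opNorm_le_bound _ (by positivity) fun h => ?_
  have e : fderiv ℝ (b.damp θ) x h =
      ∑ n ∈ Finset.range m, (θ (b.tail n x) * b.coord n h) • b n +
      ∑ n ∈ Finset.range m, (fderiv ℝ θ (b.tail n x) (b.tail n h) * b.coord n x) • b n := by
    rw [hm, ← Finset.sum_add_distrib, _root_.sum_apply]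
    refine Finset.sum_congr rfl fun n _ => ?_
    simp [add_smul, mul_comm]
  rw [e]
  refine (norm_add_le _ _).trans ?_
  have h1 := b.norm_sum_mul_coord_smul_le hK (Finset.range m) (fun n => θ (b.tail n x))
    zero_le_one (fun n _ => ?_) h
  · have h2 := norm_sum_mul_coord_smul_le_of_small_tail hK m x
      (fun n => fderiv ℝ θ (b.tail n x) (b.tail n h))
      (by positivity : 0 ≤ S * ((1 + K) * ‖h‖)) (fun n => ?_) (fun n hn => ?_)
    · calc _ ≤ _ := add_le_add h1 h2
        _ = _ := by ring
    · refine ((fderiv ℝ θ (b.tail n x)).le_of_opNorm_le (hθ.norm_fderiv_le _) _).trans ?_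
      gcongr
      exact b.norm_tail_le hK n h
    · rw [fderiv_eq_zero_of_one_lt_norm hθ hn]
      simp
  · rw [abs_of_nonneg (hθ.nonneg _)]
    exact hθ.le_one _

end UnconditionalSchauderBasis

/-- Arbitrarily small `C¹` perturbations of the identity, with uniformly bounded derivatives, all
of whose components have their differentials in `M`. -/
theorem exists_contDiff_near_id {E : Type*} [NormedAddCommGroup E] [NormedSpace ℝ E]
    [CompleteSpace E] (b : UnconditionalSchauderBasis ℕ ℝ E) {M : Submodule ℝ (E →L[ℝ] ℝ)}
    {θ : E → ℝ} {a S : ℝ} (hθ : IsCutoff M θ a S) (hM : ∀ n, b.coord n ∈ M) :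
    ∃ C : ℝ, 0 < C ∧ ∀ δ : ℝ, 0 < δ → ∃ Ψ : E → E, ContDiff ℝ 1 Ψ ∧ (∀ x, ‖Ψ x - x‖ ≤ δ) ∧
      (∀ x, ‖fderiv ℝ Ψ x‖ ≤ C) ∧ ∀ x (l : E →L[ℝ] ℝ), l.comp (fderiv ℝ Ψ x) ∈ M := by
  obtain ⟨K, hK⟩ := b.exists_norm_proj_le
  have hK0 : 0 ≤ K := (norm_nonneg _).trans (hK ∅)
  have hS0 : 0 ≤ S := (norm_nonneg _).trans (hθ.norm_fderiv_le 0)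
  have ha := hθ.pos
  refine ⟨2 * K + 2 * K * (S * (1 + K)) + 1, by positivity, fun δ hδ => ?_⟩
  -- Conjugating by a homothety scales the displacement, at most `a + 2 * K`, and leaves the
  -- derivative bound unchanged.
  set c : ℝ := δ / (a + 2 * K) with hc
  have hc0 : 0 < c := by positivity
  have hdamp := UnconditionalSchauderBasis.contDiff_damp (b := b) hK hθ
  have hder : ∀ x, fderiv ℝ (fun y => c • b.damp θ (c⁻¹ • y)) x
      = fderiv ℝ (b.damp θ) (c⁻¹ • x) := by
    intro x
    have h1 : HasFDerivAt (fun y : E => c⁻¹ • y) (c⁻¹ • ContinuousLinearMap.id ℝ E) x :=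
      (hasFDerivAt_id x).const_smul c⁻¹
    have h2 := (((hdamp.differentiable (by simp) (c⁻¹ • x)).hasFDerivAt).comp x h1).const_smul c
    refine h2.fderiv.trans ?_
    ext h
    simp [hc0.ne']
  refine ⟨fun x => c • b.damp θ (c⁻¹ • x), ?_, fun x => ?_, fun x => ?_, fun x l => ?_⟩
  · exact (hdamp.comp (contDiff_id.const_smul c⁻¹)).const_smul c
  · have e : c • b.damp θ (c⁻¹ • x) - x = c • (b.damp θ (c⁻¹ • x) - c⁻¹ • x) := by
      rw [smul_sub, smul_smul, mul_inv_cancel₀ hc0.ne', one_smul]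
    rw [e, norm_smul, Real.norm_of_nonneg hc0.le]
    calc _ ≤ c * (a + 2 * K) := by
          gcongr; exact UnconditionalSchauderBasis.norm_damp_sub_le hK hθ _
      _ = δ := by rw [hc]; field_simp
  · rw [hder]
    linarith [UnconditionalSchauderBasis.norm_fderiv_damp_le (b := b) hK hθ (c⁻¹ • x)]
  · rw [hder]
    exact UnconditionalSchauderBasis.comp_fderiv_damp_mem hK hθ hM _ l

/-! ### Partitions of unity. -/

/-- A `C¹` partition of unity, subordinate to balls of prescribed radii, made of functions with
bounded derivatives whose differentials belong to `M`. -/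
theorem IsCutoff.exists_partition {E : Type*} [NormedAddCommGroup E] [NormedSpace ℝ E]
    [SecondCountableTopology E] {M : Submodule ℝ (E →L[ℝ] ℝ)} {θ : E → ℝ} {a S : ℝ}
    (hθ : IsCutoff M θ a S) {U : Set E} (hU : U.Nonempty) (r : E → ℝ) (hr : ∀ x ∈ U, 0 < r x) :
    ∃ (x : ℕ → E) (φ : ℕ → E → ℝ), (∀ n, x n ∈ U) ∧ (∀ n, ContDiff ℝ 1 (φ n)) ∧
      (∀ n y, 0 ≤ φ n y) ∧ (∀ n, tsupport (φ n) ⊆ Metric.ball (x n) (r (x n))) ∧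
      (∀ n, ∃ K, ∀ y, ‖fderiv ℝ (φ n) y‖ ≤ K) ∧ (∀ n y, fderiv ℝ (φ n) y ∈ M) ∧
      ∀ y ∈ U, ∃ m, ∀ᶠ z in 𝓝 y, (∀ n, m ≤ n → φ n z = 0) ∧
        ∑ n ∈ Finset.range m, φ n z = 1 := by
  have ha := hθ.pos
  obtain ⟨t, htU, htc, hcov⟩ := TopologicalSpace.countable_cover_nhdsWithin (s := U)
    (f := fun x => Metric.ball x (a * r x / 2)) fun x hx =>
      mem_nhdsWithin_of_mem_nhds (Metric.ball_mem_nhds x (by have := hr x hx; positivity))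
  have htne : t.Nonempty := by
    obtain ⟨y, hy⟩ := hU
    obtain ⟨x, hx, -⟩ := mem_iUnion₂.1 (hcov hy)
    exact ⟨x, hx⟩
  obtain ⟨x, rfl⟩ := htc.exists_eq_range htne
  have hxU : ∀ n, x n ∈ U := fun n => htU (mem_range_self n)
  have hrx : ∀ n, 0 < r (x n) := fun n => hr _ (hxU n)
  set τ : ℕ → E → ℝ := fun n y => θ ((2 / r (x n)) • (y - x n)) with hτ
  -- The partition functions are `P n - P (n + 1) = P n * (1 - τ n)`: they telescope, and the sum
  -- reaches `1` once some `τ k` vanishes.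
  set P : ℕ → E → ℝ := fun n y => ∏ j ∈ Finset.range n, τ j y with hP
  have hτd : ∀ n y, HasFDerivAt (τ n)
      ((2 / r (x n)) • fderiv ℝ θ ((2 / r (x n)) • (y - x n))) y := by
    intro n y
    have h1 : HasFDerivAt (fun y : E => (2 / r (x n)) • (y - x n))
        ((2 / r (x n)) • ContinuousLinearMap.id ℝ E) y :=
      ((hasFDerivAt_id y).sub_const (x n)).const_smul _
    have h2 := ((hθ.contDiff.differentiable (by simp)
      ((2 / r (x n)) • (y - x n))).hasFDerivAt).comp y h1
    rwa [ContinuousLinearMap.comp_smul, ContinuousLinearMap.comp_id] at h2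
  have hτ0 : ∀ n y, 0 ≤ τ n y := fun n y => hθ.nonneg _
  have hτ1 : ∀ n y, τ n y ≤ 1 := fun n y => hθ.le_one _
  have hPsucc : ∀ n y, P (n + 1) y = P n y * τ n y := fun n y => Finset.prod_range_succ _ _
  have hP0 : ∀ n y, 0 ≤ P n y := fun n y => Finset.prod_nonneg fun j _ => hτ0 j y
  have hP1 : ∀ n y, P n y ≤ 1 := fun n y =>
    Finset.prod_le_one (fun j _ => hτ0 j y) fun j _ => hτ1 j y
  have hPc : ∀ n, ContDiff ℝ 1 (P n) := fun n => contDiff_prod fun j _ =>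
    hθ.contDiff.comp ((contDiff_id.sub contDiff_const).const_smul _)
  have hPd : ∀ n y, HasFDerivAt (P n) (fderiv ℝ (P n) y) y := fun n y =>
    ((hPc n).differentiable (by simp) y).hasFDerivAt
  have hPsd : ∀ n y, fderiv ℝ (P (n + 1)) y = P n y • ((2 / r (x n)) •
      fderiv ℝ θ ((2 / r (x n)) • (y - x n))) + τ n y • fderiv ℝ (P n) y := by
    intro n y
    have : P (n + 1) = fun y => P n y * τ n y := funext (hPsucc n)
    rw [this]
    exact ((hPd n y).mul (hτd n y)).fderiv
  have hPzero : ∀ y, fderiv ℝ (P 0) y = 0 := fun y => by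
    have : P 0 = fun _ => 1 := funext fun y => Finset.prod_range_zero _
    rw [this]; simp
  have hPM : ∀ n y, fderiv ℝ (P n) y ∈ M := by
    intro n y
    induction n with
    | zero => rw [hPzero]; exact zero_mem _
    | succ n ih =>
      rw [hPsd]
      exact M.add_mem (M.smul_mem _ (M.smul_mem _ (hθ.fderiv_mem _))) (M.smul_mem _ ih)
  have hPK : ∀ n, ∃ K, ∀ y, ‖fderiv ℝ (P n) y‖ ≤ K := by
    intro n
    induction n with
    | zero => exact ⟨0, fun y => by rw [hPzero]; simp⟩
    | succ n ih =>
      obtain ⟨K, hK⟩ := ih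
      have h2r : 0 ≤ 2 / r (x n) := by have := hrx n; positivity
      refine ⟨1 * (2 / r (x n) * S) + 1 * K, fun y => ?_⟩
      rw [hPsd]
      refine (norm_add_le _ _).trans ?_
      rw [norm_smul, norm_smul, norm_smul, Real.norm_of_nonneg (hP0 n y),
        Real.norm_of_nonneg (hτ0 n y), Real.norm_of_nonneg h2r]
      gcongr
      · exact hP1 n y
      · exact hθ.norm_fderiv_le _
      · exact hτ1 n y
      · exact hK y
  have hfd : ∀ n y, fderiv ℝ (fun z => P n z - P (n + 1) z) y =
      fderiv ℝ (P n) y - fderiv ℝ (P (n + 1)) y := fun n y => ((hPd n y).sub (hPd (n + 1) y)).fderiv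
  refine ⟨x, fun n y => P n y - P (n + 1) y, hxU, fun n => (hPc n).sub (hPc (n + 1)), fun n y => ?_,
    fun n => ?_, fun n => ?_, fun n y => ?_, fun y hy => ?_⟩
  · have := mul_le_of_le_one_right (hP0 n y) (hτ1 n y)
    change 0 ≤ P n y - P (n + 1) y
    rw [hPsucc]
    linarith
  · have hsub : tsupport (fun y => P n y - P (n + 1) y) ⊆
        Metric.closedBall (x n) (r (x n) / 2) := by
      refine closure_minimal (fun y hy => ?_) Metric.isClosed_closedBall
      by_contra hcon
      rw [mem_closedBall_iff_norm, not_le] at hcon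
      refine hy ?_
      have : τ n y = 1 := by
        refine hθ.eq_one _ ?_
        have h2r : 0 < 2 / r (x n) := by have := hrx n; positivity
        rw [norm_smul, Real.norm_of_nonneg h2r.le]
        calc (1 : ℝ) = 2 / r (x n) * (r (x n) / 2) := by have := (hrx n).ne'; field_simp
          _ ≤ _ := by gcongr
      simp [hPsucc, this]
    exact hsub.trans (Metric.closedBall_subset_ball (half_lt_self (hrx n)))
  · obtain ⟨K, hK⟩ := hPK n
    obtain ⟨K', hK'⟩ := hPK (n + 1)
    exact ⟨K + K', fun y => by rw [hfd]; exact (norm_sub_le _ _).trans (add_le_add (hK y) (hK' y))⟩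
  · rw [hfd]
    exact M.sub_mem (hPM n y) (hPM (n + 1) y)
  · obtain ⟨_, ⟨k, rfl⟩, hk⟩ := mem_iUnion₂.1 (hcov hy)
    refine ⟨k + 1, ?_⟩
    filter_upwards [Metric.isOpen_ball.mem_nhds hk] with z hz
    have hkz : τ k z = 0 := by
      refine hθ.eq_zero _ ?_
      have h2r : 0 < 2 / r (x k) := by have := hrx k; positivity
      rw [norm_smul, Real.norm_of_nonneg h2r.le]
      rw [mem_ball_iff_norm] at hz
      calc _ < 2 / r (x k) * (a * r (x k) / 2) := by gcongr
        _ = a := by have := (hrx k).ne'; field_simp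
    have hPz : ∀ n, k + 1 ≤ n → P n z = 0 := fun n hn =>
      Finset.prod_eq_zero (Finset.mem_range.2 hn) hkz
    refine ⟨fun n hn => ?_, ?_⟩
    · rw [hPz n hn, hPz (n + 1) (by omega), sub_zero]
    · rw [Finset.sum_range_sub' (fun n => P n z), hPz _ le_rfl]
      simp [hP]

/-! ### Operators independent modulo a countable span. -/

/-- A countable subset of an infinite-dimensional Banach space does not span it algebraically. -/
theorem Set.Countable.exists_notMem_span {V : Type*} [NormedAddCommGroup V] [NormedSpace ℝ V]
    [CompleteSpace V] (hV : ¬ FiniteDimensional ℝ V) {s : Set V} (hs : s.Countable) :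
    ∃ v, v ∉ Submodule.span ℝ s := by
  by_contra! hcon
  have : Countable s := hs.to_subtype
  classical
  let f : Finset s → Submodule ℝ V := fun F => Submodule.span ℝ (F.image Subtype.val : Finset V)
  have hfin : ∀ F, FiniteDimensional ℝ (f F) := fun F => inferInstance
  have hU : ⋃ F, (f F : Set V) = univ := by
    refine eq_univ_of_forall fun v => ?_
    obtain ⟨T, hT, hv⟩ := Submodule.mem_span_finite_of_mem_span (hcon v)
    refine mem_iUnion.2 ⟨T.subtype (· ∈ s), ?_⟩
    refine Submodule.span_mono (fun w hw => ?_) hv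
    simpa using ⟨hw, hT hw⟩
  -- Baire: one of countably many closed finite-dimensional subspaces would have interior, hence be
  -- everything.
  obtain ⟨F, hF⟩ := nonempty_interior_of_iUnion_of_closed
    (fun F => (f F).closed_of_finiteDimensional) hU
  have htop := (f F).eq_top_of_nonempty_interior' hF
  have := hfin F
  rw [htop] at this
  exact hV (Submodule.topEquiv.finiteDimensional)

theorem Set.Countable.exists_independent_mod_span {V : Type*} [NormedAddCommGroup V]
    [NormedSpace ℝ V] [CompleteSpace V] (hV : ¬ FiniteDimensional ℝ V) (d : ℕ) {s : Set V}
    (hs : s.Countable) :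
    ∃ t : Fin d → V, ∀ c : Fin d → ℝ, ∑ i, c i • t i ∈ Submodule.span ℝ s → c = 0 := by
  induction d generalizing s with
  | zero => exact ⟨0, fun c _ => Subsingleton.elim _ _⟩
  | succ d ih =>
    obtain ⟨v, hv⟩ := hs.exists_notMem_span hV
    obtain ⟨t, ht⟩ := ih (hs.insert v)
    refine ⟨Fin.cons v t, fun c hc => ?_⟩
    rw [Fin.sum_univ_succ] at hc
    simp only [Fin.cons_zero, Fin.cons_succ] at hc
    have h1 : (fun i => c (Fin.succ i)) = 0 := by
      refine ht _ ?_
      have h2 : c 0 • v ∈ Submodule.span ℝ (insert v s) :=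
        Submodule.smul_mem _ _ (Submodule.subset_span (mem_insert _ _))
      have h3 := Submodule.span_mono (R := ℝ) (subset_insert v s) hc
      exact ((Submodule.add_mem_iff_right _ h2).1 h3)
    have h4 : ∀ i : Fin d, c i.succ = 0 := fun i => congrFun h1 i
    simp only [h4, zero_smul, Finset.sum_const_zero, add_zero] at hc
    have h5 : c 0 = 0 := by
      by_contra h0
      exact hv ((Submodule.smul_mem_iff _ h0).1 hc)
    funext i
    exact Fin.cases h5 h4 i

theorem not_finiteDimensional_dual {E : Type*} [NormedAddCommGroup E] [NormedSpace ℝ E]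
    (hE : ¬ FiniteDimensional ℝ E) : ¬ FiniteDimensional ℝ (E →L[ℝ] ℝ) := fun _ => hE <|
  FiniteDimensional.of_injective (NormedSpace.inclusionInDoubleDualLi ℝ (E := E)).toLinearMap
    (NormedSpace.inclusionInDoubleDualLi ℝ (E := E)).injective

/-- There is an operator into `ℝᵈ` none of whose nontrivial components lies in a given countably
spanned space of functionals. -/
theorem exists_clm_forall_comp_mem_span {E : Type*} [NormedAddCommGroup E] [NormedSpace ℝ E]
    (hE : ¬ FiniteDimensional ℝ E) (d : ℕ) {s : Set (E →L[ℝ] ℝ)} (hs : s.Countable) :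
    ∃ T : E →L[ℝ] EuclideanSpace ℝ (Fin d), ∀ l : EuclideanSpace ℝ (Fin d) →L[ℝ] ℝ,
      l.comp T ∈ Submodule.span ℝ s → l = 0 := by
  obtain ⟨t, ht⟩ := hs.exists_independent_mod_span (not_finiteDimensional_dual hE) d
  refine ⟨∑ i, (t i).smulRight (EuclideanSpace.single i (1 : ℝ)), fun l hl => ?_⟩
  have e : l.comp (∑ i, (t i).smulRight (EuclideanSpace.single i (1 : ℝ))) =
      ∑ i, l (EuclideanSpace.single i (1 : ℝ)) • t i := by
    ext x
    simp [mul_comm]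
  rw [e] at hl
  have h0 := ht _ hl
  have : (l : EuclideanSpace ℝ (Fin d) →ₗ[ℝ] ℝ) = 0 := by
    refine (EuclideanSpace.basisFun (Fin d) ℝ).toBasis.ext fun i => ?_
    simpa using congrFun h0 i
  ext x
  exact congrArg (fun L : EuclideanSpace ℝ (Fin d) →ₗ[ℝ] ℝ => L x) this

/-- A perturbation of an operator with components in `M` by an operator whose components are
independent modulo `M` is surjective. -/
theorem ContinuousLinearMap.surjective_of_comp_sub_mem {E F : Type*} [NormedAddCommGroup E]
    [NormedSpace ℝ E] [NormedAddCommGroup F] [NormedSpace ℝ F] [FiniteDimensional ℝ F]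
    {M : Submodule ℝ (E →L[ℝ] ℝ)} {T D : E →L[ℝ] F} {ρ : ℝ} (hρ : ρ ≠ 0)
    (hT : ∀ l : F →L[ℝ] ℝ, l.comp T ∈ M → l = 0)
    (hD : ∀ l : F →L[ℝ] ℝ, l.comp (D - ρ • T) ∈ M) : Function.Surjective D := by
  by_contra hns
  have hlt : LinearMap.range (D : E →ₗ[ℝ] F) < ⊤ :=
    lt_top_iff_ne_top.2 fun h => hns (LinearMap.range_eq_top.1 h)
  obtain ⟨l, hl0, hl⟩ := Submodule.exists_le_ker_of_lt_top _ hlt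
  have hlD : (LinearMap.toContinuousLinearMap l).comp D = 0 := by
    ext x
    exact hl (LinearMap.mem_range_self (D : E →ₗ[ℝ] F) x)
  have h1 := hD (LinearMap.toContinuousLinearMap l)
  rw [ContinuousLinearMap.comp_sub, hlD, zero_sub, ContinuousLinearMap.comp_smul,
    Submodule.neg_mem_iff, Submodule.smul_mem_iff _ hρ] at h1
  refine hl0 ?_
  have := hT _ h1
  ext x
  exact congrArg (fun L : F →L[ℝ] ℝ => L x) this

/-! ### Local approximation and gluing. -/

/-- On a ball where the derivative of `f` is almost constant, `f` is `C¹`-close to a map whose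
derivative differs from a constant by an operator with components in `M`. -/
theorem exists_approx_on_ball {E F : Type*} [NormedAddCommGroup E] [NormedSpace ℝ E]
    [NormedAddCommGroup F] [NormedSpace ℝ F] {M : Submodule ℝ (E →L[ℝ] ℝ)} {C : ℝ}
    (hΨ : ∀ δ : ℝ, 0 < δ → ∃ Ψ : E → E, ContDiff ℝ 1 Ψ ∧ (∀ x, ‖Ψ x - x‖ ≤ δ) ∧
      (∀ x, ‖fderiv ℝ Ψ x‖ ≤ C) ∧ ∀ x (l : E →L[ℝ] ℝ), l.comp (fderiv ℝ Ψ x) ∈ M)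
    {f : E → F} {x₀ : E} {r η κ : ℝ} (hr : 0 < r) (hη : 0 < η) (hκ : 0 < κ) (A : E →L[ℝ] F)
    (hf : ContDiffOn ℝ 1 f (Metric.ball x₀ (2 * r)))
    (hA : ∀ y ∈ Metric.ball x₀ (2 * r), ‖fderiv ℝ f y - A‖ ≤ η) :
    ∃ h : E → F, ContDiffOn ℝ 1 h (Metric.ball x₀ r) ∧
      ∀ y ∈ Metric.ball x₀ r, ‖h y - f y‖ ≤ κ ∧ ‖fderiv ℝ h y - fderiv ℝ f y‖ ≤ η * (C + 1) ∧
        ∀ l : F →L[ℝ] ℝ, l.comp (fderiv ℝ h y - A) ∈ M := by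
  -- `r / 2` keeps `Ψ y` in the double ball; `κ / η` suits the mean value inequality for `f - A`,
  -- which is `η`-Lipschitz there.
  obtain ⟨Ψ, hΨc, hΨδ, hΨC, hΨM⟩ := hΨ (min (r / 2) (κ / η)) (by positivity)
  have hmaps : ∀ y ∈ Metric.ball x₀ r, Ψ y ∈ Metric.ball x₀ (2 * r) := fun y hy => by
    rw [mem_ball_iff_norm] at hy ⊢
    have h1 := (hΨδ y).trans (min_le_left _ _)
    calc ‖Ψ y - x₀‖ = ‖(Ψ y - y) + (y - x₀)‖ := by congr 1; abel
      _ ≤ _ := norm_add_le _ _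
      _ < _ := by linarith
  have hsub : Metric.ball x₀ r ⊆ Metric.ball x₀ (2 * r) := Metric.ball_subset_ball (by linarith)
  have hfd : ∀ y ∈ Metric.ball x₀ (2 * r), DifferentiableAt ℝ f y := fun y hy =>
    (hf.contDiffAt (Metric.isOpen_ball.mem_nhds hy)).differentiableAt (by simp)
  refine ⟨fun y => f (Ψ y) + A (y - Ψ y), ?_, fun y hy => ⟨?_, ?_⟩⟩
  · refine (hf.comp hΨc.contDiffOn hmaps).add ?_
    exact (A.contDiff.comp (contDiff_id.sub hΨc)).contDiffOn
  · have e : f (Ψ y) + A (y - Ψ y) - f y = f (Ψ y) - f y - A (Ψ y - y) := by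
      rw [map_sub, map_sub]; abel
    rw [e]
    refine ((convex_ball x₀ (2 * r)).norm_image_sub_le_of_norm_fderiv_le' hfd hA (hsub hy)
      (hmaps y hy)).trans ?_
    calc _ ≤ η * (κ / η) := by gcongr; exact (hΨδ y).trans (min_le_right _ _)
      _ = κ := by field_simp
  · have hΨy : HasFDerivAt Ψ (fderiv ℝ Ψ y) y :=
      (hΨc.differentiable (by simp) y).hasFDerivAt
    have hder : fderiv ℝ (fun y => f (Ψ y) + A (y - Ψ y)) y =
        A + (fderiv ℝ f (Ψ y) - A).comp (fderiv ℝ Ψ y) := by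
      have h1 := ((hfd _ (hmaps y hy)).hasFDerivAt.comp y hΨy).add
        (A.hasFDerivAt.comp y ((hasFDerivAt_id y).sub hΨy))
      refine h1.fderiv.trans ?_
      rw [ContinuousLinearMap.comp_sub, ContinuousLinearMap.sub_comp, ContinuousLinearMap.comp_id]
      abel
    rw [hder]
    refine ⟨?_, fun l => ?_⟩
    · have e : A + (fderiv ℝ f (Ψ y) - A).comp (fderiv ℝ Ψ y) - fderiv ℝ f y =
          (fderiv ℝ f (Ψ y) - A).comp (fderiv ℝ Ψ y) - (fderiv ℝ f y - A) := by abel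
      rw [e]
      calc _ ≤ _ := norm_sub_le _ _
        _ ≤ η * C + η := by
          refine add_le_add ((ContinuousLinearMap.opNorm_comp_le _ _).trans ?_) (hA y (hsub hy))
          exact mul_le_mul (hA _ (hmaps y hy)) (hΨC y) (norm_nonneg _) hη.le
        _ = _ := by ring
    · rw [add_sub_cancel_left, ← ContinuousLinearMap.comp_assoc]
      exact hΨM y _

/-- The derivative of a locally finite sum `∑ φₙ • kₙ`, where `kₙ` is only assumed to be `C¹` on
an open set containing the support of `φₙ`. -/
theorem exists_contDiffAt_tsum_smul {E F : Type*} [NormedAddCommGroup E] [NormedSpace ℝ E]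
    [NormedAddCommGroup F] [NormedSpace ℝ F] {φ : ℕ → E → ℝ} {k : ℕ → E → F} {V : ℕ → Set E}
    (hV : ∀ n, IsOpen (V n)) (hφ : ∀ n, ContDiff ℝ 1 (φ n)) (hφV : ∀ n, tsupport (φ n) ⊆ V n)
    (hk : ∀ n, ContDiffOn ℝ 1 (k n) (V n)) {y : E} {m : ℕ}
    (hm : ∀ᶠ z in 𝓝 y, ∀ n, m ≤ n → φ n z = 0) :
    ContDiffAt ℝ 1 (fun z => ∑' n, φ n z • k n z) y ∧
    ∑' n, φ n y • k n y = ∑ n ∈ Finset.range m, φ n y • k n y ∧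
    fderiv ℝ (fun z => ∑' n, φ n z • k n z) y =
      ∑ n ∈ Finset.range m, (φ n y • fderiv ℝ (k n) y + (fderiv ℝ (φ n) y).smulRight (k n y)) := by
  have heq : (fun z => ∑' n, φ n z • k n z) =ᶠ[𝓝 y]
      fun z => ∑ n ∈ Finset.range m, φ n z • k n z := by
    filter_upwards [hm] with z hz
    refine tsum_eq_sum fun n hn => ?_
    rw [hz n (by simpa using hn), zero_smul]
  have hkey : ∀ n, ContDiffAt ℝ 1 (fun z => φ n z • k n z) y ∧ HasFDerivAt (fun z => φ n z • k n z)
      (φ n y • fderiv ℝ (k n) y + (fderiv ℝ (φ n) y).smulRight (k n y)) y := by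
    intro n
    by_cases hy : y ∈ V n
    · have hkn := (hk n).contDiffAt ((hV n).mem_nhds hy)
      exact ⟨(hφ n).contDiffAt.smul hkn, ((hφ n).differentiable (by simp) y).hasFDerivAt.smul
        (hkn.differentiableAt (by simp)).hasFDerivAt⟩
    · have h0 : φ n =ᶠ[𝓝 y] 0 := notMem_tsupport_iff_eventuallyEq.1 fun h => hy (hφV n h)
      have h1 : (fun z => φ n z • k n z) =ᶠ[𝓝 y] fun _ => 0 := by
        filter_upwards [h0] with z hz
        simp [hz]
      refine ⟨contDiffAt_const.congr_of_eventuallyEq h1, ?_⟩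
      have h2 : fderiv ℝ (φ n) y = 0 := by rw [h0.fderiv_eq]; simp
      have h3 : φ n y = 0 := h0.self_of_nhds
      rw [h2, h3]
      simpa using (hasFDerivAt_const (𝕜 := ℝ) (0 : F) y).congr_of_eventuallyEq h1
  refine ⟨(ContDiffAt.sum fun n _ => (hkey n).1).congr_of_eventuallyEq heq, heq.self_of_nhds, ?_⟩
  exact ((HasFDerivAt.fun_sum fun n _ => (hkey n).2).congr_of_eventuallyEq heq).fderiv

theorem sum_range_pow_half_le (m : ℕ) :
    ∑ n ∈ Finset.range m, (1 / 2 : ℝ) ^ (n + 2) ≤ 1 / 2 := by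
  have h := Summable.sum_le_tsum (Finset.range m) (fun n _ => by positivity) summable_geometric_two
  rw [tsum_geometric_two] at h
  simp_rw [pow_add, ← Finset.sum_mul]
  linarith

/-- Gluing by a partition of unity approximations of `f` which are close enough compared with the
derivatives of the partition functions. -/
theorem norm_sub_glue_le {E F : Type*} [NormedAddCommGroup E] [NormedSpace ℝ E]
    [NormedAddCommGroup F] [NormedSpace ℝ F] {φ : ℕ → E → ℝ} {k : ℕ → E → F} {V : ℕ → Set E}
    {K : ℕ → ℝ} {f : E → F} {y : E} {e : ℝ} (he : 0 < e) {m : ℕ} (hφ : ∀ n, ContDiff ℝ 1 (φ n))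
    (hφ0 : ∀ n, 0 ≤ φ n y) (hφV : ∀ n, tsupport (φ n) ⊆ V n)
    (hK : ∀ n, ‖fderiv ℝ (φ n) y‖ ≤ K n)
    (hm : ∀ᶠ z in 𝓝 y, ∑ n ∈ Finset.range m, φ n z = 1)
    (hk0 : ∀ n, y ∈ V n → ‖k n y - f y‖ ≤ (1 / 2 : ℝ) ^ (n + 2) / (1 + K n) * e)
    (hk1 : ∀ n, y ∈ V n → ‖fderiv ℝ (k n) y - fderiv ℝ f y‖ ≤ e / 2) :
    ‖f y - ∑ n ∈ Finset.range m, φ n y • k n y‖ ≤ e ∧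
    ‖fderiv ℝ f y - ∑ n ∈ Finset.range m,
      (φ n y • fderiv ℝ (k n) y + (fderiv ℝ (φ n) y).smulRight (k n y))‖ ≤ e := by
  have hK0 : ∀ n, 0 ≤ K n := fun n => (norm_nonneg _).trans (hK n)
  have hsum : ∑ n ∈ Finset.range m, φ n y = 1 := hm.self_of_nhds
  have hdsum : ∑ n ∈ Finset.range m, fderiv ℝ (φ n) y = 0 := by
    -- The differentials of a partition of unity sum to zero, so `k n` may be replaced by `k n - f`
    -- in the terms with `Dφ n`.
    rw [← fderiv_fun_sum fun n _ => (hφ n).differentiable (by simp) y]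
    have : (fun z => ∑ n ∈ Finset.range m, φ n z) =ᶠ[𝓝 y] fun _ => 1 := hm
    rw [this.fderiv_eq]; simp
  have hout : ∀ n, y ∉ V n → φ n y = 0 ∧ fderiv ℝ (φ n) y = 0 := fun n hy => by
    have h0 : φ n =ᶠ[𝓝 y] 0 := notMem_tsupport_iff_eventuallyEq.1 fun h => hy (hφV n h)
    exact ⟨h0.self_of_nhds, by rw [h0.fderiv_eq]; simp⟩
  have hconv : ∑ n ∈ Finset.range m, φ n y * (e / 2) = e / 2 := by
    rw [← Finset.sum_mul, hsum, one_mul]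
  constructor
  · have e1 : f y - ∑ n ∈ Finset.range m, φ n y • k n y =
        ∑ n ∈ Finset.range m, φ n y • (f y - k n y) := by
      simp only [smul_sub, Finset.sum_sub_distrib, ← Finset.sum_smul, hsum, one_smul]
    rw [e1]
    calc _ ≤ ∑ n ∈ Finset.range m, φ n y * (e / 2) := by
          refine norm_sum_le_of_le _ fun n _ => ?_
          by_cases hy : y ∈ V n
          · rw [norm_smul, Real.norm_of_nonneg (hφ0 n), norm_sub_rev]
            refine mul_le_mul_of_nonneg_left ((hk0 n hy).trans ?_) (hφ0 n)
            have h1 : (1 / 2 : ℝ) ^ (n + 2) ≤ 1 / 2 :=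
              (pow_le_pow_of_le_one (by norm_num) (by norm_num) (by omega : 1 ≤ n + 2)).trans_eq
                (pow_one _)
            have h2 : (1 / 2 : ℝ) ^ (n + 2) / (1 + K n) ≤ 1 / 2 :=
              (div_le_self (by positivity) (by linarith [hK0 n])).trans h1
            calc _ ≤ 1 / 2 * e := by gcongr
              _ = e / 2 := by ring
          · simp [(hout n hy).1]
      _ ≤ e := by rw [hconv]; linarith
  · have e2 : fderiv ℝ f y - ∑ n ∈ Finset.range m,
        (φ n y • fderiv ℝ (k n) y + (fderiv ℝ (φ n) y).smulRight (k n y)) =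
        -∑ n ∈ Finset.range m, (φ n y • (fderiv ℝ (k n) y - fderiv ℝ f y) +
          (fderiv ℝ (φ n) y).smulRight (k n y - f y)) := by
      have h1 : ∑ n ∈ Finset.range m, φ n y • fderiv ℝ f y = fderiv ℝ f y := by
        rw [← Finset.sum_smul, hsum, one_smul]
      have h2 : ∑ n ∈ Finset.range m, (fderiv ℝ (φ n) y).smulRight (f y) = 0 := by
        ext h
        have := congrArg (fun L : E →L[ℝ] ℝ => L h) hdsum
        simp only [_root_.sum_apply, ContinuousLinearMap.smulRight_apply, ← Finset.sum_smul,
          _root_.zero_apply] at this ⊢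
        rw [this, zero_smul]
      have h3 : ∀ n, (fderiv ℝ (φ n) y).smulRight (k n y - f y) =
          (fderiv ℝ (φ n) y).smulRight (k n y) - (fderiv ℝ (φ n) y).smulRight (f y) := fun n => by
        ext h; simp [smul_sub]
      simp only [smul_sub, h3, Finset.sum_add_distrib, Finset.sum_sub_distrib, h1, h2]
      abel
    rw [e2, norm_neg]
    calc _ ≤ ∑ n ∈ Finset.range m, (φ n y * (e / 2) + (1 / 2 : ℝ) ^ (n + 2) * e) := by
          refine norm_sum_le_of_le _ fun n _ => ?_
          by_cases hy : y ∈ V n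
          · refine (norm_add_le _ _).trans (add_le_add ?_ ?_)
            · rw [norm_smul, Real.norm_of_nonneg (hφ0 n)]
              exact mul_le_mul_of_nonneg_left (hk1 n hy) (hφ0 n)
            · rw [ContinuousLinearMap.norm_smulRight_apply]
              calc _ ≤ (1 + K n) * ((1 / 2 : ℝ) ^ (n + 2) / (1 + K n) * e) :=
                    mul_le_mul (by linarith [hK n]) (hk0 n hy) (norm_nonneg _)
                      (by linarith [hK0 n])
                _ = _ := by have : 1 + K n ≠ 0 := by linarith [hK0 n]
                            field_simp
          · rw [(hout n hy).1, (hout n hy).2]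
            have : (0 : ℝ) ≤ (1 / 2 : ℝ) ^ (n + 2) * e := by positivity
            simpa using this
      _ ≤ e := by
          rw [Finset.sum_add_distrib, hconv, ← Finset.sum_mul]
          have := mul_le_mul_of_nonneg_right (sum_range_pow_half_le m) he.le
          linarith

/-! ### Assembly of the perturbation. -/

theorem UnconditionalSchauderBasis.secondCountableTopology {E : Type*} [NormedAddCommGroup E]
    [NormedSpace ℝ E] (b : UnconditionalSchauderBasis ℕ ℝ E) : SecondCountableTopology E := by
  have hs : TopologicalSpace.IsSeparable (closure (Submodule.span ℝ (range b.basis) : Set E)) :=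
    (countable_range b.basis).isSeparable.span.closure
  have hU : closure (Submodule.span ℝ (range b.basis) : Set E) = univ := by
    refine eq_univ_of_forall fun x => mem_closure_of_tendsto (b.expansion x).tendsto_sum_nat
      (Eventually.of_forall fun n => ?_)
    exact Submodule.sum_mem _ fun i _ =>
      Submodule.smul_mem _ _ (Submodule.subset_span (mem_range_self i))
  rw [hU, TopologicalSpace.isSeparable_univ_iff] at hs
  exact UniformSpace.secondCountable_of_separable E

/-- Every point of an open set has a ball on which a `C¹` map has almost constant derivative and a
positive continuous function does not fall below half its value at the centre. -/
theorem exists_ball_fderiv_almost_const {E F : Type*} [NormedAddCommGroup E] [NormedSpace ℝ E]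
    [NormedAddCommGroup F] [NormedSpace ℝ F] {U : Set E} (hU : IsOpen U) {f : E → F}
    (hf : ContDiffOn ℝ 1 f U) {ε : E → ℝ} (hε : ContinuousOn ε U) {x : E} (hx : x ∈ U)
    (hεx : 0 < ε x) {η : ℝ} (hη : 0 < η) :
    ∃ r, 0 < r ∧ Metric.ball x (2 * r) ⊆ U ∧
      ∀ y ∈ Metric.ball x (2 * r), ‖fderiv ℝ f y - fderiv ℝ f x‖ ≤ η ∧ ε x / 2 ≤ ε y := by
  have h1 : ∀ᶠ y in 𝓝 x, ε x / 2 < ε y :=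
    (hε.continuousAt (hU.mem_nhds hx)).eventually (lt_mem_nhds (half_lt_self hεx))
  have h2 : ∀ᶠ y in 𝓝 x, fderiv ℝ f y ∈ Metric.ball (fderiv ℝ f x) η :=
    ((hf.continuousOn_fderiv_of_isOpen hU le_rfl).continuousAt (hU.mem_nhds hx)).eventually
      (Metric.ball_mem_nhds _ hη)
  obtain ⟨R, hR, hball⟩ := Metric.eventually_nhds_iff_ball.1 ((h1.and h2).and (hU.mem_nhds hx))
  refine ⟨R / 2, by positivity, fun y hy => ?_, fun y hy => ?_⟩
  · exact (hball y (by rwa [mul_div_cancel₀ R two_ne_zero] at hy)).2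
  · obtain ⟨⟨h1, h2⟩, -⟩ := hball y (by rwa [mul_div_cancel₀ R two_ne_zero] at hy)
    exact ⟨(mem_ball_iff_norm.1 h2).le, h1.le⟩

theorem theorem3p1 {E : Type*} [NormedAddCommGroup E] [NormedSpace ℝ E] [CompleteSpace E]
    (hE : ¬ FiniteDimensional ℝ E)
    (hbasis : Nonempty (UnconditionalSchauderBasis ℕ ℝ E))
    (hnorm : ∃ N : Seminorm ℝ E,
      IsEquivalentNorm N ∧ IsC1Norm N ∧ LocallyDependsOnFinitelyManyCoordinates N)
    (d : ℕ) (U : Set E) (hU : IsOpen U)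
    (f : E → EuclideanSpace ℝ (Fin d)) (hf : ContDiffOn ℝ 1 f U)
    (ε : E → ℝ) (hε : ContinuousOn ε U) (hε_pos : ∀ x ∈ U, 0 < ε x) :
    ∃ g : E → EuclideanSpace ℝ (Fin d), ContDiffOn ℝ 1 g U ∧
      (∀ x ∈ U, ‖f x - g x‖ ≤ ε x) ∧
      (∀ x ∈ U, ‖fderiv ℝ f x - fderiv ℝ g x‖ ≤ ε x) ∧
      criticalSet g U = ∅ := by
  obtain ⟨b⟩ := hbasis
  obtain ⟨N, hN, hN1, hNL⟩ := hnorm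
  have := b.secondCountableTopology
  rcases U.eq_empty_or_nonempty with rfl | hne
  · exact ⟨f, hf, by simp, by simp, by simp [criticalSet]⟩
  obtain ⟨s₀, θ, a, S, hs₀, hθ₀⟩ := exists_isCutoff hN hN1 hNL
  set s : Set (E →L[ℝ] ℝ) := s₀ ∪ range b.coord with hs
  have hsc : s.Countable := hs₀.union (countable_range _)
  have hθ : IsCutoff (Submodule.span ℝ s) θ a S :=
    { hθ₀ with fderiv_mem := fun z => Submodule.span_mono subset_union_left (hθ₀.fderiv_mem z) }
  obtain ⟨C, hC, hΨ⟩ := exists_contDiff_near_id b hθ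
    fun n => Submodule.subset_span (Or.inr (mem_range_self n))
  -- With this `η`, the derivative error `η * (C + 1)` of the local approximation is `ε x / 8`.
  choose! r hr hrU hrball using fun x (hx : x ∈ U) =>
    exists_ball_fderiv_almost_const hU hf hε hx (hε_pos x hx)
      (η := ε x / (8 * (C + 1))) (by have := hε_pos x hx; positivity)
  obtain ⟨x, φ, hxU, hφ, hφ0, hφV, hφK, hφM, hφ1⟩ := hθ.exists_partition hne r hr
  choose K hK using hφK
  have hK0 : ∀ n, 0 ≤ K n := fun n => (norm_nonneg _).trans (hK n 0)
  have hεx : ∀ n, 0 < ε (x n) := fun n => hε_pos _ (hxU n)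
  have hsub : ∀ n, Metric.ball (x n) (r (x n)) ⊆ Metric.ball (x n) (2 * r (x n)) := fun n =>
    Metric.ball_subset_ball (by linarith [hr _ (hxU n)])
  -- the tolerance on the `n`-th ball
  set κ : ℕ → ℝ := fun n => (1 / 2 : ℝ) ^ (n + 2) / (1 + K n) * (ε (x n) / 4) with hκdef
  have hκ : ∀ n, 0 < κ n := fun n => by have := hεx n; have := hK0 n; positivity
  choose h hh hhn using fun n => exists_approx_on_ball hΨ (hr _ (hxU n))
    (η := ε (x n) / (8 * (C + 1))) (by have := hεx n; positivity) (hκ n) (fderiv ℝ f (x n))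
    (hf.mono (hrU _ (hxU n))) fun y hy => (hrball _ (hxU n) y hy).1
  set s' : Set (E →L[ℝ] ℝ) := s ∪ range fun p : ℕ × Fin d =>
    (EuclideanSpace.proj p.2 : EuclideanSpace ℝ (Fin d) →L[ℝ] ℝ).comp (fderiv ℝ f (x p.1)) with hs'
  have hs'c : s'.Countable := hsc.union (countable_range _)
  have hss' : Submodule.span ℝ s ≤ Submodule.span ℝ s' := Submodule.span_mono subset_union_left
  have hfs' : ∀ n (l : EuclideanSpace ℝ (Fin d) →L[ℝ] ℝ),
      l.comp (fderiv ℝ f (x n)) ∈ Submodule.span ℝ s' := by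
    intro n l
    have e : l.comp (fderiv ℝ f (x n)) = ∑ i, l (EuclideanSpace.single i 1) •
        (EuclideanSpace.proj i : EuclideanSpace ℝ (Fin d) →L[ℝ] ℝ).comp (fderiv ℝ f (x n)) := by
      ext v
      have := congrArg l ((EuclideanSpace.basisFun (Fin d) ℝ).sum_repr (fderiv ℝ f (x n) v))
      rw [map_sum] at this
      simpa [mul_comm] using this.symm
    rw [e]
    exact Submodule.sum_mem _ fun i _ =>
      Submodule.smul_mem _ _ (Submodule.subset_span (Or.inr ⟨(n, i), rfl⟩))
  obtain ⟨T, hT⟩ := exists_clm_forall_comp_mem_span hE d hs'c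
  -- The first bound makes `c n • T` at most `κ n` on the ball, the second makes its operator norm
  -- at most `ε (x n) / 8`.
  set c : ℕ → ℝ := fun n => min (κ n / (1 + ‖T‖ * (‖x n‖ + r (x n)))) (ε (x n) / 8 / (1 + ‖T‖))
    with hcdef
  have hden : ∀ n, 0 < 1 + ‖T‖ * (‖x n‖ + r (x n)) := fun n => by
    have := hr _ (hxU n); positivity
  have hc : ∀ n, 0 < c n := fun n =>
    lt_min (div_pos (hκ n) (hden n)) (by have := hεx n; positivity)
  set k : ℕ → E → EuclideanSpace ℝ (Fin d) := fun n y => h n y + c n • T y with hkdef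
  have hkc : ∀ n, ContDiffOn ℝ 1 (k n) (Metric.ball (x n) (r (x n))) := fun n =>
    (hh n).add (T.contDiff.const_smul (c n)).contDiffOn
  have hkd : ∀ n, ∀ y ∈ Metric.ball (x n) (r (x n)),
      fderiv ℝ (k n) y = fderiv ℝ (h n) y + c n • T := fun n y hy =>
    ((((hh n).contDiffAt (Metric.isOpen_ball.mem_nhds hy)).differentiableAt
      (by simp)).hasFDerivAt.add (T.hasFDerivAt.const_smul (c n))).fderiv
  have hεy : ∀ n, ∀ y ∈ Metric.ball (x n) (r (x n)), ε (x n) / 2 ≤ ε y := fun n y hy =>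
    (hrball _ (hxU n) y (hsub n hy)).2
  have hk0 : ∀ n, ∀ y ∈ Metric.ball (x n) (r (x n)),
      ‖k n y - f y‖ ≤ (1 / 2 : ℝ) ^ (n + 2) / (1 + K n) * ε y := by
    intro n y hy
    have e : k n y - f y = (h n y - f y) + c n • T y := by simp only [hkdef]; abel
    have hy' : ‖y‖ ≤ ‖x n‖ + r (x n) := by
      have h1 := (mem_ball_iff_norm.1 hy).le
      have h2 := norm_add_le (x n) (y - x n)
      rw [add_sub_cancel] at h2
      linarith
    have hTy : ‖c n • T y‖ ≤ κ n := by
      rw [norm_smul, Real.norm_of_nonneg (hc n).le]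
      calc _ ≤ κ n / (1 + ‖T‖ * (‖x n‖ + r (x n))) * (1 + ‖T‖ * (‖x n‖ + r (x n))) := by
            refine mul_le_mul (min_le_left _ _) ?_ (norm_nonneg _)
              (div_pos (hκ n) (hden n)).le
            have h1 := T.le_opNorm y
            have h2 := mul_le_mul_of_nonneg_left hy' (norm_nonneg T)
            linarith
        _ = κ n := div_mul_cancel₀ _ (hden n).ne'
    rw [e]
    calc _ ≤ κ n + κ n := (norm_add_le _ _).trans (add_le_add (hhn n y hy).1 hTy)
      _ = (1 / 2 : ℝ) ^ (n + 2) / (1 + K n) * (ε (x n) / 2) := by simp only [hκdef]; ring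
      _ ≤ _ := by
        have := hK0 n
        gcongr
        exact hεy n y hy
  have hk1 : ∀ n, ∀ y ∈ Metric.ball (x n) (r (x n)),
      ‖fderiv ℝ (k n) y - fderiv ℝ f y‖ ≤ ε y / 2 := by
    intro n y hy
    have e : fderiv ℝ (k n) y - fderiv ℝ f y =
        (fderiv ℝ (h n) y - fderiv ℝ f y) + c n • T := by rw [hkd n y hy]; abel
    have hTn : ‖c n • T‖ ≤ ε (x n) / 8 := by
      rw [norm_smul, Real.norm_of_nonneg (hc n).le]
      have hT1 : 0 < 1 + ‖T‖ := by positivity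
      calc _ ≤ ε (x n) / 8 / (1 + ‖T‖) * (1 + ‖T‖) := by
            refine mul_le_mul (min_le_right _ _) (by linarith) (norm_nonneg _) ?_
            have := hεx n
            positivity
        _ = _ := div_mul_cancel₀ _ hT1.ne'
    have h1 := (hhn n y hy).2.1
    have h2 : ε (x n) / (8 * (C + 1)) * (C + 1) = ε (x n) / 8 := by field_simp
    rw [e]
    refine (norm_add_le _ _).trans ?_
    linarith [hεy n y hy]
  refine ⟨fun y => ∑' n, φ n y • k n y, fun y hy => ?_, fun y hy => ?_, fun y hy => ?_, ?_⟩
  · obtain ⟨m, hm⟩ := hφ1 y hy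
    exact (exists_contDiffAt_tsum_smul (fun _ => Metric.isOpen_ball) hφ hφV hkc
      (hm.mono fun _ h => h.1)).1.contDiffWithinAt
  · obtain ⟨m, hm⟩ := hφ1 y hy
    simp only [(exists_contDiffAt_tsum_smul (fun _ => Metric.isOpen_ball) hφ hφV hkc
      (hm.mono fun _ h => h.1)).2.1]
    exact (norm_sub_glue_le (hε_pos y hy) hφ (fun n => hφ0 n y) hφV (fun n => hK n y)
      (hm.mono fun _ h => h.2) (fun n => hk0 n y) fun n => hk1 n y).1
  · obtain ⟨m, hm⟩ := hφ1 y hy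
    rw [(exists_contDiffAt_tsum_smul (fun _ => Metric.isOpen_ball) hφ hφV hkc
      (hm.mono fun _ h => h.1)).2.2]
    exact (norm_sub_glue_le (hε_pos y hy) hφ (fun n => hφ0 n y) hφV (fun n => hK n y)
      (hm.mono fun _ h => h.2) (fun n => hk0 n y) fun n => hk1 n y).2
  · refine eq_empty_of_forall_notMem fun y hy => hy.2 ?_
    obtain ⟨m, hm⟩ := hφ1 y hy.1
    rw [(exists_contDiffAt_tsum_smul (fun _ => Metric.isOpen_ball) hφ hφV hkc
      (hm.mono fun _ h => h.1)).2.2]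
    -- The coefficient of `T` in `Dg y` is a convex combination of positive numbers.
    have hρ : ∑ n ∈ Finset.range m, φ n y * c n ≠ 0 := by
      intro h0
      rw [Finset.sum_eq_zero_iff_of_nonneg fun n _ => mul_nonneg (hφ0 n y) (hc n).le] at h0
      have h1 : ∑ n ∈ Finset.range m, φ n y = 0 := Finset.sum_eq_zero fun n hn =>
        (mul_eq_zero.1 (h0 n hn)).resolve_right (hc n).ne'
      exact one_ne_zero (hm.self_of_nhds.2.symm.trans h1)
    refine ContinuousLinearMap.surjective_of_comp_sub_mem hρ hT fun l => ?_
    rw [Finset.sum_smul, ← Finset.sum_sub_distrib, ContinuousLinearMap.comp_finsetSum]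
    refine Submodule.sum_mem _ fun n _ => ?_
    have hR : l.comp ((fderiv ℝ (φ n) y).smulRight (k n y)) ∈ Submodule.span ℝ s' := by
      have : l.comp ((fderiv ℝ (φ n) y).smulRight (k n y)) = l (k n y) • fderiv ℝ (φ n) y := by
        ext v; simp [mul_comm]
      rw [this]
      exact Submodule.smul_mem _ _ (hss' (hφM n y))
    by_cases hyn : y ∈ Metric.ball (x n) (r (x n))
    · have e : φ n y • fderiv ℝ (k n) y + (fderiv ℝ (φ n) y).smulRight (k n y) -
          (φ n y * c n) • T = φ n y • ((fderiv ℝ (h n) y - fderiv ℝ f (x n)) + fderiv ℝ f (x n)) +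
          (fderiv ℝ (φ n) y).smulRight (k n y) := by
        rw [hkd n y hyn]; module
      rw [e, ContinuousLinearMap.comp_add, ContinuousLinearMap.comp_smul,
        ContinuousLinearMap.comp_add]
      exact Submodule.add_mem _ (Submodule.smul_mem _ _ (Submodule.add_mem _
        (hss' ((hhn n y hyn).2.2 l)) (hfs' n l))) hR
    · have h0 : φ n y = 0 := image_eq_zero_of_notMem_tsupport fun h => hyn (hφV n h)
      rw [h0, zero_mul, zero_smul, zero_smul, zero_add, sub_zero]
      exact hR
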